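/- Let $K\ge 2$ and let $\mathsf P$ be the set of non-empty subsets of the receiver set $[1:K]$. In the $K$-user combination network, the input $X$ has one component $V_S\in\mathcal V_S$ for each $S\in\mathsf P$, where $\mathcal V_S$ is a finite alphabet with $|\mathcal V_S|=2^{C_S}$, and receiver $i$ noiselessly receives exactly the components $V_S$ with $i\in S$, that is, $Y_i=(V_S)_{S\in\mathsf P,\, i\in S}$; the network is used as a (noiseless) discrete memoryless broadcast channel. For $i\in[1:K]$ put $\overline{i}=[1:K]\setminus\{i\}$ and $\mathsf W_i=\{S\in\mathsf P: i\in S\}$; for $\mathsf W\subseteq\mathsf P$ put $C_{\mathsf W}=\sum_{S\in\mathsf W}C_S$; and for $\mathsf Q_1,\mathsf Q_2\subseteq\mathsf P$ let $\downarrow_{\mathsf Q_2}\mathsf Q_1=\{S\in\mathsf Q_2: S\subseteq T\text{ for some }T\in\mathsf Q_1\}$. Let $S_p=\{1,\dots,K-2\}$ (empty if $K=2$). Two independent messages $M_{\overline{K}}$ and $M_{\overline{K-1}}$, uniformly distributed on $\lceil 2^{nR_{\overline{K}}}\rceil$ and $\lceil 2^{nR_{\overline{K-1}}}\rceil$ values,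 are sent in $n$ channel uses; $M_{\overline{K}}$ must be decoded by all receivers except $K$, and $M_{\overline{K-1}}$ by all receivers except $K-1$. A pair of non-negative rates $(R_{\overline{K}},R_{\overline{K-1}})$ is achievable if there is a sequence of codes, one for each block length $n$, for which the probability that some receiver fails to decode a message intended for it tends to $0$ as $n\to\infty$; the capacity region is the closure of the set of achievable rate pairs. **Theorem.** The capacity region of the $K$-user combination network with the two messages $M_{\overline{K}}$, $M_{\overline{K-1}}$ is the set of pairs $(R_{\overline{K}},R_{\overline{K-1}})$ of non-negative real numbers satisfying $$ \begin{aligned} R_{\overline{K-1}} &\le C_{\mathsf W_K},\\ R_{\overline{K}} &\le C_{\mathsf W_{K-1}},\\ R_{\overline{K-1}}+R_{\overline{K}} &\le C_{\mathsf W_j} && \text{for all } j\in S_p,\\ R_{\overline{K-1}}+R_{\overline{K}} &\le C_{\downarrow_{\mathsf W_{K-1}}\{\overline{K}\}}+C_{\mathsf W_K},\\ 2R_{\overline{K-1}}+2R_{\overline{K}} &\le C_{\downarrow_{\mathsf W_j}\{\overline{K-1},\overline{K}\}}+C_{\mathsf W_K}+C_{\mathsf W_{K-1}} && \text{for all } j\in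 S_p. \end{aligned} $$ Moreover, the fourth inequality is equivalent to $R_{\overline{K-1}}+R_{\overline{K}}\le C_{\downarrow_{\mathsf W_K}\{\overline{K-1}\}}+C_{\mathsf W_{K-1}}$. -/

import Mathlib

open Filter Topology

namespace CombinationNetwork

/-! ### Message indices, up/down-sets -/

/-- The ground set `P`: the non-empty subsets of the set of receivers. Receivers `1, …, K` are the
elements of `Fin K` (receiver `i` is the element with value `i - 1`). The order is inclusion. -/
abbrev Idx (K : ℕ) : Type := {S : Finset (Fin K) // S.Nonempty}

/-- `W_i^F`: the indices in `F` that contain receiver `i`. -/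
def containing {K : ℕ} (i : Fin K) (F : Finset (Idx K)) : Finset (Idx K) :=
  F.filter (fun S => i ∈ S.1)

/-- `↓_{Q₂} Q₁ = (↓_P Q₁) ∩ Q₂`: the members of `Q₂` that are contained in some member of `Q₁`. -/
def downIn {K : ℕ} (Q₂ Q₁ : Finset (Idx K)) : Finset (Idx K) :=
  Q₂.filter (fun S => ∃ T ∈ Q₁, S.1 ⊆ T.1)

/-- The modular function `C_W = ∑_{S ∈ W} C_S`. -/
def capSum {K : ℕ} (C : Idx K → ℝ) (W : Finset (Idx K)) : ℝ := ∑ S ∈ W, C S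

/-! ### Discrete memoryless broadcast channels -/

/-- A discrete memoryless broadcast channel with `K` receivers, finite input alphabet `X` and finite
output alphabets `Y k`: `prob x y` is the probability `W(y₁, …, y_K | x)`. -/
structure DMBC (K : ℕ) (X : Type*) (Y : Fin K → Type*) [∀ k, Fintype (Y k)] where
  prob : X → (∀ k, Y k) → ℝ
  prob_nonneg : ∀ x y, 0 ≤ prob x y
  prob_sum : ∀ x, ∑ y, prob x y = 1

/-- A block code of length `n` for the messages `M_S`, `S ∈ E`, where `M_S` takes `size S` values.
The decoder of receiver `k` outputs an estimate of `M_S` for each `S ∈ E` with `k ∈ S`. -/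
structure Code {K : ℕ} (X : Type*) (Y : Fin K → Type*) (E : Finset (Idx K)) (size : E → ℕ)
    (n : ℕ) where
  enc : (∀ S : E, Fin (size S)) → (Fin n → X)
  dec : ∀ k : Fin K, (Fin n → Y k) → ∀ S : E, k ∈ S.1.1 → Fin (size S)

section Region

variable {K : ℕ} {X : Type*} {Y : Fin K → Type*} [∀ k, Fintype (Y k)]

/-- On message tuple `m` and output block `y`, some receiver decodes some message intended for it
incorrectly. -/
def Code.Errs {E : Finset (Idx K)} {size : E → ℕ} {n : ℕ} (c : Code X Y E size n)
    (m : ∀ S : E, Fin (size S)) (y : Fin n → ∀ k, Y k) : Prop :=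
  ∃ (k : Fin K) (S : E) (h : k ∈ S.1.1), c.dec k (fun t => y t k) S h ≠ m S

open Classical in
/-- The probability of error: the messages are independent and uniformly distributed, and the
channel is used `n` times without memory. -/
noncomputable def Code.errorProb {E : Finset (Idx K)} {size : E → ℕ} {n : ℕ}
    (c : Code X Y E size n) (ch : DMBC K X Y) : ℝ :=
  (∑ m : ∀ S : E, Fin (size S), ∑ y : Fin n → ∀ k, Y k,
      if c.Errs m y then ∏ t, ch.prob (c.enc m t) (y t) else 0)
    / (Fintype.card (∀ S : E, Fin (size S)) : ℝ)

/-- The number of values of a message of rate `r` at block length `n`, i.e. `2^{nr}` rounded up. -/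
noncomputable def messageSize (n : ℕ) (r : ℝ) : ℕ := ⌈(2 : ℝ) ^ ((n : ℝ) * r)⌉₊

/-- A tuple of (non-negative) rates is achievable if there is a sequence of codes with these rates
whose error probability tends to zero. -/
def Achievable (ch : DMBC K X Y) (E : Finset (Idx K)) (R : E → ℝ) : Prop :=
  (∀ S, 0 ≤ R S) ∧
  ∃ c : ∀ n : ℕ, Code X Y E (fun S => messageSize n (R S)) n,
    Tendsto (fun n => (c n).errorProb ch) atTop (𝓝 0)

/-- The capacity region: the closure of the set of achievable rate tuples. -/
def capacityRegion (ch : DMBC K X Y) (E : Finset (Idx K)) : Set (E → ℝ) :=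
  closure {R | Achievable ch E R}

end Region

/-! ### The combination network -/

/-- The input of the combination network: one component `V_S` for each `S ∈ P`. -/
abbrev Input {K : ℕ} (V : Idx K → Type*) : Type _ := ∀ S : Idx K, V S

/-- The output of receiver `k`: the components `V_S` with `S ∈ W_k^P`. -/
abbrev Output {K : ℕ} (V : Idx K → Type*) (k : Fin K) : Type _ :=
  ∀ S : {S : Idx K // S ∈ containing k Finset.univ}, V S.1

/-- What receiver `k` sees of the input `x`: it receives the components `V_S` with `k ∈ S`. -/
def received {K : ℕ} {V : Idx K → Type*} (x : Input V) (k : Fin K) : Output V k :=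
  fun S => x S.1

open Classical in
/-- The combination network as a broadcast channel: the component `V_S` of the input is received
noiselessly by the receivers in `S`, and not received by the others. -/
noncomputable def network {K : ℕ} (V : Idx K → Type*) [∀ S, Fintype (V S)] :
    DMBC K (Input V) (Output V) where
  prob x y := if y = received x then 1 else 0
  prob_nonneg x y := by split_ifs <;> norm_num
  prob_sum x := by simp

/-! ### The two messages, each intended for all receivers but one -/

/-- Receiver `K`. -/
def rxLast {K : ℕ} (hK : 2 ≤ K) : Fin K := ⟨K - 1, by omega⟩

/-- Receiver `K - 1`. -/
def rxPrev {K : ℕ} (hK : 2 ≤ K) : Fin K := ⟨K - 2, by omega⟩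

/-- The index `ī`: the set of all receivers but `i`. -/
def allBut {K : ℕ} (hK : 2 ≤ K) (i : Fin K) : Idx K :=
  ⟨{i}ᶜ, by
    rw [← Finset.card_pos, Finset.card_compl, Finset.card_singleton, Fintype.card_fin]
    omega⟩

/-- The message index set consisting of all receivers but `K`, and all receivers but `K - 1`. -/
def twoMsgs {K : ℕ} (hK : 2 ≤ K) : Finset (Idx K) :=
  {allBut hK (rxLast hK), allBut hK (rxPrev hK)}

/-- The index of the message for all receivers but `K`, as a member of the message index set. -/
def msgNotLast {K : ℕ} (hK : 2 ≤ K) : twoMsgs hK :=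
  ⟨allBut hK (rxLast hK), by simp [twoMsgs]⟩

/-- The index of the message for all receivers but `K - 1`, as a member of the message index set. -/
def msgNotPrev {K : ℕ} (hK : 2 ≤ K) : twoMsgs hK :=
  ⟨allBut hK (rxPrev hK), by simp [twoMsgs]⟩

end CombinationNetwork

open CombinationNetwork

/-! The network is deterministic, so the error probability is the fraction of message pairs outside
a set `G` of correctly decoded pairs, and the converse is a count: `G` contains at least half of all
pairs, and this constant factor disappears from the rates as `n → ∞`. The first four bounds follow
from injections of `G` into what one or two receivers see (`mul_size_le_of_rxPrev`,
`mul_size_le_of_rxLast`, `mul_size_le_of_view`).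

The last bound is a counting form of an entropy argument (`card_sq_le_of_fiber_bounds`). Split `G`
into fibers by what receivers `K` and `K - 1` both see. The rest of what receiver `j` sees bounds
each fiber. Each fiber is also at most the product of the numbers of values of the two messages on
it. Multiplying the two bounds and summing their square roots by Cauchy-Schwarz leaves the sizes of
the outputs of receivers `K - 1` and `K`.

Achievability is rate splitting with superposed random coding. Each message has a common part, sent
on every component and decoded by everybody, and a private part, sent only on components whose
receivers all want it. A union bound (`tendsto_unionBound`) reduces reliability to one linear
inequality per receiver and set of parts. Making each common part as large as the receiver that does
not want it allows satisfies all of them (`mem_capacityRegion_of_bounds`). -/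

namespace CombinationNetwork

/-! ### Codes over a deterministic network and counting inequalities -/

section Deterministic

variable {K : ℕ} {V : Idx K → Type*} {E : Finset (Idx K)} {size : E → ℕ} {n : ℕ}

open Classical in
/-- The message tuples that all receivers decode correctly over the combination network. -/
noncomputable def Code.goodSet (c : Code (Input V) (Output V) E size n) :
    Finset (∀ S : E, Fin (size S)) :=
  Finset.univ.filter fun m => ¬ c.Errs m (fun t => received (c.enc m t))

/-- The components of the codeword of `m` indexed by `W`. -/
def Code.view (c : Code (Input V) (Output V) E size n) (W : Finset (Idx K))
    (m : ∀ S : E, Fin (size S)) : Fin n → ∀ S : W, V S.1 :=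
  fun t S => c.enc m t S.1

theorem Code.view_mono (c : Code (Input V) (Output V) E size n) {W W' : Finset (Idx K)}
    (hW : W ⊆ W') {m m' : ∀ S : E, Fin (size S)} (h : c.view W' m = c.view W' m') :
    c.view W m = c.view W m' := by
  funext t S
  exact congrFun (congrFun h t) ⟨S.1, hW S.2⟩

theorem Code.view_union (c : Code (Input V) (Output V) E size n) {W W₁ W₂ : Finset (Idx K)}
    (hW : ∀ S ∈ W, S ∈ W₁ ∨ S ∈ W₂) {m m' : ∀ S : E, Fin (size S)}
    (h₁ : c.view W₁ m = c.view W₁ m') (h₂ : c.view W₂ m = c.view W₂ m') :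
    c.view W m = c.view W m' := by
  funext t S
  rcases hW S.1 S.2 with h | h
  · exact congrFun (congrFun h₁ t) ⟨S.1, h⟩
  · exact congrFun (congrFun h₂ t) ⟨S.1, h⟩

/-- On correctly decoded messages, what a receiver sees determines its intended messages. -/
theorem Code.eq_of_view_eq (c : Code (Input V) (Output V) E size n)
    {m m' : ∀ S : E, Fin (size S)} (hm : m ∈ c.goodSet) (hm' : m' ∈ c.goodSet)
    {k : Fin K} {S : E} (hk : k ∈ S.1.1)
    (h : c.view (containing k Finset.univ) m = c.view (containing k Finset.univ) m') :
    m S = m' S := by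
  simp only [Code.goodSet, Code.Errs, Finset.mem_filter, Finset.mem_univ, true_and, not_exists,
    not_not] at hm hm'
  rw [← hm k S hk, ← hm' k S hk]
  exact congrArg (fun y => c.dec k y S hk) h

variable [∀ S, Fintype (V S)]

/-- Given the codeword, all probability sits on the single output block `received`, so the error
probability is a proportion of message tuples. -/
theorem Code.errorProb_network (c : Code (Input V) (Output V) E size n) :
    c.errorProb (network V) =
      ((c.goodSetᶜ).card : ℝ) / (Fintype.card (∀ S : E, Fin (size S)) : ℝ) := by
  classical
  unfold Code.errorProb
  congr 1
  have h : ∀ m : ∀ S : E, Fin (size S), (∑ y : Fin n → ∀ k, Output V k,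
      if c.Errs m y then ∏ t, (network V).prob (c.enc m t) (y t) else 0) =
      if c.Errs m (fun t => received (c.enc m t)) then (1 : ℝ) else 0 := by
    intro m
    rw [Finset.sum_eq_single (fun t => received (c.enc m t))]
    · simp [network]
    · intro y _ hy
      obtain ⟨t, ht⟩ := Function.ne_iff.1 hy
      rw [Finset.prod_eq_zero (Finset.mem_univ t)]
      · simp
      · simp [network, ht]
    · simp
  calc _ = ∑ m : ∀ S : E, Fin (size S),
        if c.Errs m (fun t => received (c.enc m t)) then (1 : ℝ) else 0 := by
        refine Finset.sum_congr rfl fun m _ => ?_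
        rw [← h m]
    _ = _ := by
        rw [Finset.sum_boole]
        congr 2
        ext m
        simp [Code.goodSet]

theorem Code.card_le_two_mul_card_goodSet (c : Code (Input V) (Output V) E size n)
    (h : c.errorProb (network V) ≤ 1 / 2) :
    (Fintype.card (∀ S : E, Fin (size S)) : ℝ) ≤ 2 * c.goodSet.card := by
  classical
  rw [c.errorProb_network] at h
  have h1 : (c.goodSetᶜ.card : ℝ) + c.goodSet.card =
      Fintype.card (∀ S : E, Fin (size S)) := by
    exact_mod_cast Finset.card_compl_add_card c.goodSet
  rcases (Nat.cast_nonneg (α := ℝ) (Fintype.card (∀ S : E, Fin (size S)))).eq_or_lt with h0 | h0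
  · rw [← h0]; positivity
  · rw [div_le_iff₀ h0] at h
    linarith

theorem card_block {C : Idx K → ℝ} (hC : ∀ S, (Fintype.card (V S) : ℝ) = (2 : ℝ) ^ C S)
    (W : Finset (Idx K)) (n : ℕ) :
    (Fintype.card (Fin n → ∀ S : W, V S.1) : ℝ) = (2 : ℝ) ^ ((n : ℝ) * capSum C W) := by
  classical
  rw [Fintype.card_fun, Fintype.card_pi, Fintype.card_fin, mul_comm, Real.rpow_mul (by norm_num),
    Real.rpow_natCast, capSum, Real.rpow_sum_of_pos (by norm_num), ← Finset.prod_coe_sort W]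
  push_cast
  congr 1
  exact Finset.prod_congr rfl fun S _ => hC _

/-- Any constant factor `c` is beaten by `2 ^ (n (a - b))` when `a > b`; this absorbs the 2 or 4
lost by restricting to good tuples. -/
theorem le_of_eventually_rpow_le {a b c : ℝ}
    (h : ∀ᶠ n : ℕ in atTop, (2 : ℝ) ^ ((n : ℝ) * a) ≤ c * (2 : ℝ) ^ ((n : ℝ) * b)) : a ≤ b := by
  by_contra! hab
  have h1 : Tendsto (fun n : ℕ => ((2 : ℝ) ^ (a - b)) ^ n) atTop atTop :=
    tendsto_pow_atTop_atTop_of_one_lt (Real.one_lt_rpow (by norm_num) (by linarith))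
  obtain ⟨n, hn, hn'⟩ := (h.and (h1.eventually_gt_atTop c)).exists
  have h2 : (2 : ℝ) ^ ((n : ℝ) * a) = ((2 : ℝ) ^ (a - b)) ^ n * (2 : ℝ) ^ ((n : ℝ) * b) := by
    rw [← Real.rpow_natCast, ← Real.rpow_mul (by norm_num), ← Real.rpow_add (by norm_num)]
    congr 1; ring
  have h3 : (0 : ℝ) < (2 : ℝ) ^ ((n : ℝ) * b) := by positivity
  rw [h2] at hn
  exact absurd (le_of_mul_le_mul_right hn h3) (not_le.2 hn')

theorem sum_card_image_fiber {M A D : Type*} [DecidableEq A] [DecidableEq D] (G : Finset M)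
    (d : M → D) (f : M → A) :
    ∑ x ∈ G.image d, ((G.filter fun m => d m = x).image f).card =
      (G.image fun m => (d m, f m)).card := by
  rw [Finset.card_eq_sum_card_fiberwise (f := Prod.fst) (t := G.image d)]
  · refine Finset.sum_congr rfl fun x _ => ?_
    rw [← Finset.card_image_of_injective _ (Prod.mk_right_injective x)]
    congr 1
    ext ⟨x', y⟩
    simp only [Finset.mem_image, Finset.mem_filter, Prod.mk.injEq]
    constructor
    · rintro ⟨_, ⟨m, ⟨hm, rfl⟩, rfl⟩, rfl, rfl⟩
      exact ⟨⟨m, hm, rfl, rfl⟩, rfl⟩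
    · rintro ⟨⟨m, hm, rfl, rfl⟩, rfl⟩
      exact ⟨_, ⟨m, ⟨hm, rfl⟩, rfl⟩, rfl, rfl⟩
  · intro p hp
    obtain ⟨m, hm, rfl⟩ := Finset.mem_image.1 hp
    exact Finset.mem_image_of_mem d hm

/-- A fiber of `d` with `a` values of `f` and `b` values of `g` has size at most `a * b` and at most
`J`, hence at most `√(J a) √b`. Cauchy-Schwarz over the fibers turns the sums of `a` and `b` into
counts of pairs `(d, f)` and `(d, g)`. -/
theorem card_sq_le_of_fiber_bounds {M A B D : Type*} [DecidableEq A] [DecidableEq B]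
    [DecidableEq D] (G : Finset M) (d : M → D) (f : M → A) (g : M → B)
    (J Na Nb : ℕ)
    (hinj : ∀ m ∈ G, ∀ m' ∈ G, f m = f m' → g m = g m' → m = m')
    (hJ : ∀ x, (G.filter fun m => d m = x).card ≤ J)
    (hA : (G.image fun m => (d m, f m)).card ≤ Na)
    (hB : (G.image fun m => (d m, g m)).card ≤ Nb) :
    (G.card : ℝ) ^ 2 ≤ J * Na * Nb := by
  set I := G.image d with hI
  have hfib : ∀ x, (((G.filter fun m => d m = x).card : ℕ) : ℝ) ≤
      √(J * ((G.filter fun m => d m = x).image f).card) *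
        √(((G.filter fun m => d m = x).image g).card) := by
    intro x
    rw [← Real.sqrt_mul (by positivity)]
    refine Real.le_sqrt_of_sq_le ?_
    have h1 : (G.filter fun m => d m = x).card ≤
        ((G.filter fun m => d m = x).image f).card *
          ((G.filter fun m => d m = x).image g).card := by
      rw [← Finset.card_product]
      refine Finset.card_le_card_of_injOn (fun m => (f m, g m)) ?_ ?_
      · intro m hm
        exact Finset.mk_mem_product (Finset.mem_image_of_mem f hm) (Finset.mem_image_of_mem g hm)
      · intro m hm m' hm' h
        exact hinj m (Finset.mem_filter.1 hm).1 m' (Finset.mem_filter.1 hm').1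
          (congrArg Prod.fst h) (congrArg Prod.snd h)
    have h2 := Nat.mul_le_mul (hJ x) h1
    rw [sq, mul_assoc]
    exact_mod_cast h2
  have hcard : (G.card : ℝ) = ∑ x ∈ I, (((G.filter fun m => d m = x).card : ℕ) : ℝ) := by
    exact_mod_cast Finset.card_eq_sum_card_image d G
  calc (G.card : ℝ) ^ 2 ≤ (∑ x ∈ I, √(J * ((G.filter fun m => d m = x).image f).card) *
        √(((G.filter fun m => d m = x).image g).card)) ^ 2 := by
        rw [hcard]
        exact pow_le_pow_left₀ (Finset.sum_nonneg fun _ _ => Nat.cast_nonneg _)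
          (Finset.sum_le_sum fun x _ => hfib x) 2
    _ ≤ (∑ x ∈ I, √(J * ((G.filter fun m => d m = x).image f).card) ^ 2) *
        ∑ x ∈ I, √(((G.filter fun m => d m = x).image g).card) ^ 2 :=
        Finset.sum_mul_sq_le_sq_mul_sq _ _ _
    _ = (J * ∑ x ∈ I, (((G.filter fun m => d m = x).image f).card : ℝ)) *
        ∑ x ∈ I, (((G.filter fun m => d m = x).image g).card : ℝ) := by
        rw [Finset.mul_sum I _ (J : ℝ)]
        congr 1
        · exact Finset.sum_congr rfl fun x _ => Real.sq_sqrt (by positivity)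
        · exact Finset.sum_congr rfl fun x _ => Real.sq_sqrt (Nat.cast_nonneg _)
    _ = J * (G.image fun m => (d m, f m)).card * (G.image fun m => (d m, g m)).card := by
        rw [← sum_card_image_fiber G d f, ← sum_card_image_fiber G d g]; push_cast; rfl
    _ ≤ J * Na * Nb := by gcongr

end Deterministic

theorem card_image_le_card_of_factor {M A B : Type*} [DecidableEq A] [Fintype B] (G : Finset M)
    (f : M → A) (v : M → B) (h : ∀ m ∈ G, ∀ m' ∈ G, v m = v m' → f m = f m') :
    (G.image f).card ≤ Fintype.card B := by
  classical
  have hex : ∀ x : G.image f, ∃ m ∈ G, f m = x.1 := fun x => Finset.mem_image.1 x.2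
  choose s hs hs' using hex
  rw [← Fintype.card_coe]
  refine Fintype.card_le_of_injective (fun x => v (s x)) fun x y hxy => Subtype.ext ?_
  rw [← hs' x, ← hs' y]
  exact h _ (hs x) _ (hs y) hxy

/-! ### The two messages and their receivers -/

section TwoMessages

variable {K : ℕ} (hK : 2 ≤ K)

theorem rxLast_ne_rxPrev : rxLast hK ≠ rxPrev hK := by
  simp only [rxLast, rxPrev, ne_eq, Fin.mk.injEq]
  omega

theorem mem_allBut {i k : Fin K} : k ∈ (allBut hK i).1 ↔ k ≠ i := by
  simp [allBut]

theorem subset_allBut {i : Fin K} {S : Finset (Fin K)} : S ⊆ (allBut hK i).1 ↔ i ∉ S := by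
  simp [allBut]

theorem mem_containing_univ {k : Fin K} {S : Idx K} :
    S ∈ containing k Finset.univ ↔ k ∈ S.1 := by
  simp [containing]

theorem msgNotLast_ne_msgNotPrev : msgNotLast hK ≠ msgNotPrev hK := by
  intro h
  have h1 : rxLast hK ∈ (msgNotPrev hK).1.1 := (mem_allBut hK).2 (rxLast_ne_rxPrev hK)
  rw [← h] at h1
  exact (mem_allBut hK).1 h1 rfl

theorem eq_msgNotLast_or_eq_msgNotPrev (S : twoMsgs hK) :
    S = msgNotLast hK ∨ S = msgNotPrev hK := by
  have h := S.2
  simp only [twoMsgs, Finset.mem_insert, Finset.mem_singleton] at h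
  exact h.imp Subtype.ext Subtype.ext

theorem univ_twoMsgs : (Finset.univ : Finset (twoMsgs hK)) = {msgNotLast hK, msgNotPrev hK} := by
  ext S
  simpa using eq_msgNotLast_or_eq_msgNotPrev hK S

theorem card_messages (size : twoMsgs hK → ℕ) :
    Fintype.card (∀ S : twoMsgs hK, Fin (size S)) =
      size (msgNotLast hK) * size (msgNotPrev hK) := by
  simp only [Fintype.card_pi, Fintype.card_fin]
  rw [univ_twoMsgs, Finset.prod_pair (msgNotLast_ne_msgNotPrev hK)]

theorem messages_ext {size : twoMsgs hK → ℕ} {m m' : ∀ S : twoMsgs hK, Fin (size S)}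
    (h₁ : m (msgNotLast hK) = m' (msgNotLast hK)) (h₂ : m (msgNotPrev hK) = m' (msgNotPrev hK)) :
    m = m' := by
  funext S
  rcases eq_msgNotLast_or_eq_msgNotPrev hK S with rfl | rfl
  · exact h₁
  · exact h₂

theorem rxPrev_mem_msgNotLast : rxPrev hK ∈ (msgNotLast hK).1.1 :=
  (mem_allBut hK).2 (rxLast_ne_rxPrev hK).symm

theorem rxLast_mem_msgNotPrev : rxLast hK ∈ (msgNotPrev hK).1.1 :=
  (mem_allBut hK).2 (rxLast_ne_rxPrev hK)

theorem rxLast_notMem_msgNotLast : rxLast hK ∉ (msgNotLast hK).1.1 :=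
  fun h => (mem_allBut hK).1 h rfl

theorem rxPrev_notMem_msgNotPrev : rxPrev hK ∉ (msgNotPrev hK).1.1 :=
  fun h => (mem_allBut hK).1 h rfl

theorem mem_msgNotLast_of_lt {j : Fin K} (hj : j.val < K - 2) : j ∈ (msgNotLast hK).1.1 := by
  refine (mem_allBut hK).2 fun h => ?_
  subst h
  simp only [rxLast] at hj
  omega

theorem mem_msgNotPrev_of_lt {j : Fin K} (hj : j.val < K - 2) : j ∈ (msgNotPrev hK).1.1 := by
  refine (mem_allBut hK).2 fun h => ?_
  subst h
  simp only [rxPrev] at hj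
  omega

/-- The first index set is `W_i` without `W_k`, so the sum runs over `W_i ∪ W_k`. The symmetry in
`i` and `k` is what makes the two forms of the fourth inequality equivalent. -/
theorem capSum_downIn_add_capSum (C : Idx K → ℝ) (i k : Fin K) :
    capSum C (downIn (containing i Finset.univ) {allBut hK k}) +
        capSum C (containing k Finset.univ) =
      capSum C (Finset.univ.filter fun S => i ∈ S.1 ∨ k ∈ S.1) := by
  simp only [capSum]
  rw [← Finset.sum_union]
  · refine Finset.sum_congr ?_ fun _ _ => rfl
    ext S
    simp only [Finset.mem_union, downIn, Finset.mem_filter, mem_containing_univ,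
      Finset.mem_singleton, exists_eq_left, subset_allBut, Finset.mem_univ, true_and]
    tauto
  · rw [Finset.disjoint_left]
    intro S hS hS'
    simp only [downIn, Finset.mem_filter, mem_containing_univ,
      Finset.mem_singleton, exists_eq_left, subset_allBut] at hS hS'
    exact hS.2 hS'

/-! ### Converse: counting correctly decoded message pairs -/

section Converse

variable {V : Idx K → Type*} [∀ S, Fintype (V S)] {C : Idx K → ℝ}
  {size : twoMsgs hK → ℕ} {n : ℕ}

/-- A good pair is determined by the output of receiver `K - 1` together with the message this
receiver does not decode; the size of that message cancels later. -/
theorem mul_size_le_of_rxPrev (hC : ∀ S, (Fintype.card (V S) : ℝ) = (2 : ℝ) ^ C S)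
    (c : Code (Input V) (Output V) (twoMsgs hK) size n) (h : c.errorProb (network V) ≤ 1 / 2) :
    (size (msgNotLast hK) * size (msgNotPrev hK) : ℝ) ≤
      2 * ((2 : ℝ) ^ ((n : ℝ) * capSum C (containing (rxPrev hK) Finset.univ)) *
        size (msgNotPrev hK)) := by
  classical
  have h1 := c.card_le_two_mul_card_goodSet h
  rw [card_messages, Nat.cast_mul] at h1
  refine h1.trans (mul_le_mul_of_nonneg_left ?_ (by norm_num))
  rw [← card_block hC]
  have h2 : c.goodSet.card ≤ _ := Finset.card_le_card_of_injOn
    (t := (Finset.univ : Finset ((Fin n → ∀ S : containing (rxPrev hK) Finset.univ, V S.1) ×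
      Fin (size (msgNotPrev hK)))))
    (fun m => (c.view (containing (rxPrev hK) Finset.univ) m, m (msgNotPrev hK)))
    (fun _ _ => Finset.mem_coe.2 (Finset.mem_univ _))
    (fun m hm m' hm' hmm => messages_ext hK
      (c.eq_of_view_eq hm hm' (rxPrev_mem_msgNotLast hK) (congrArg Prod.fst hmm))
      (congrArg Prod.snd hmm))
  rw [Finset.card_univ, Fintype.card_prod, Fintype.card_fin] at h2
  exact_mod_cast h2

theorem mul_size_le_of_rxLast (hC : ∀ S, (Fintype.card (V S) : ℝ) = (2 : ℝ) ^ C S)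
    (c : Code (Input V) (Output V) (twoMsgs hK) size n) (h : c.errorProb (network V) ≤ 1 / 2) :
    (size (msgNotLast hK) * size (msgNotPrev hK) : ℝ) ≤
      2 * ((2 : ℝ) ^ ((n : ℝ) * capSum C (containing (rxLast hK) Finset.univ)) *
        size (msgNotLast hK)) := by
  classical
  have h1 := c.card_le_two_mul_card_goodSet h
  rw [card_messages, Nat.cast_mul] at h1
  refine h1.trans (mul_le_mul_of_nonneg_left ?_ (by norm_num))
  rw [← card_block hC]
  have h2 : c.goodSet.card ≤ _ := Finset.card_le_card_of_injOn
    (t := (Finset.univ : Finset ((Fin n → ∀ S : containing (rxLast hK) Finset.univ, V S.1) ×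
      Fin (size (msgNotLast hK)))))
    (fun m => (c.view (containing (rxLast hK) Finset.univ) m, m (msgNotLast hK)))
    (fun _ _ => Finset.mem_coe.2 (Finset.mem_univ _))
    (fun m hm m' hm' hmm => messages_ext hK (congrArg Prod.snd hmm)
      (c.eq_of_view_eq hm hm' (rxLast_mem_msgNotPrev hK) (congrArg Prod.fst hmm)))
  rw [Finset.card_univ, Fintype.card_prod, Fintype.card_fin] at h2
  exact_mod_cast h2

/-- Used with `i = k = j` for a receiver that wants both messages, and with `W = W_{K-1} ∪ W_K` for
two cooperating receivers. -/
theorem mul_size_le_of_view (hC : ∀ S, (Fintype.card (V S) : ℝ) = (2 : ℝ) ^ C S)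
    (c : Code (Input V) (Output V) (twoMsgs hK) size n) (h : c.errorProb (network V) ≤ 1 / 2)
    {W : Finset (Idx K)} {i k : Fin K} (hi : containing i Finset.univ ⊆ W)
    (hk : containing k Finset.univ ⊆ W) (hi' : i ∈ (msgNotLast hK).1.1)
    (hk' : k ∈ (msgNotPrev hK).1.1) :
    (size (msgNotLast hK) * size (msgNotPrev hK) : ℝ) ≤ 2 * (2 : ℝ) ^ ((n : ℝ) * capSum C W) := by
  classical
  have h1 := c.card_le_two_mul_card_goodSet h
  rw [card_messages, Nat.cast_mul] at h1
  refine h1.trans (mul_le_mul_of_nonneg_left ?_ (by norm_num))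
  rw [← card_block hC]
  have h2 : c.goodSet.card ≤ _ := Finset.card_le_card_of_injOn
    (t := (Finset.univ : Finset (Fin n → ∀ S : W, V S.1))) (c.view W)
    (fun _ _ => Finset.mem_coe.2 (Finset.mem_univ _))
    (fun m hm m' hm' hmm => messages_ext hK
      (c.eq_of_view_eq hm hm' hi' (c.view_mono hi hmm))
      (c.eq_of_view_eq hm hm' hk' (c.view_mono hk hmm)))
  rw [Finset.card_univ] at h2
  exact_mod_cast h2

theorem mul_size_sq_le (hC : ∀ S, (Fintype.card (V S) : ℝ) = (2 : ℝ) ^ C S)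
    (c : Code (Input V) (Output V) (twoMsgs hK) size n) (h : c.errorProb (network V) ≤ 1 / 2)
    {j : Fin K} (hj : j.val < K - 2) :
    (size (msgNotLast hK) * size (msgNotPrev hK) : ℝ) ^ 2 ≤
      4 * (2 : ℝ) ^ ((n : ℝ) * (capSum C (downIn (containing j Finset.univ)
              {allBut hK (rxPrev hK), allBut hK (rxLast hK)}) +
            capSum C (containing (rxLast hK) Finset.univ) +
            capSum C (containing (rxPrev hK) Finset.univ))) := by
  classical
  have h1 := c.card_le_two_mul_card_goodSet h
  rw [card_messages, Nat.cast_mul] at h1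
  set J := downIn (containing j Finset.univ) {allBut hK (rxPrev hK), allBut hK (rxLast hK)}
  -- Fibers are taken over what receivers `K - 1` and `K` both see. A component seen by `j` is
  -- missed by one of them, hence in `J`, or lies in `W`.
  set W := containing (rxPrev hK) (containing (rxLast hK) Finset.univ) with hW
  have hWa : W ⊆ containing (rxPrev hK) Finset.univ := by
    intro S; simp [hW, containing]
  have hWb : W ⊆ containing (rxLast hK) Finset.univ := by
    intro S; simp +contextual [hW, containing]
  have hJ : ∀ S ∈ containing j Finset.univ, S ∈ J ∨ S ∈ W := by
    intro S hS
    simp only [J, hW, downIn, containing, Finset.mem_filter, Finset.mem_univ, true_and,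
      Finset.mem_insert, Finset.mem_singleton, exists_eq_or_imp, exists_eq_left,
      subset_allBut] at hS ⊢
    tauto
  have h2 := card_sq_le_of_fiber_bounds c.goodSet (c.view W) (fun m => m (msgNotLast hK))
    (fun m => m (msgNotPrev hK)) (Fintype.card (Fin n → ∀ S : J, V S.1))
    (Fintype.card (Fin n → ∀ S : containing (rxPrev hK) Finset.univ, V S.1))
    (Fintype.card (Fin n → ∀ S : containing (rxLast hK) Finset.univ, V S.1))
    (fun m _ m' _ h h' => messages_ext hK h h')
    (fun x => by
      rw [← Finset.card_univ]
      refine Finset.card_le_card_of_injOn (c.view J)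
        (fun _ _ => Finset.mem_coe.2 (Finset.mem_univ _)) fun m hm m' hm' hmm => ?_
      obtain ⟨hm, hmx⟩ := Finset.mem_filter.1 hm
      obtain ⟨hm', hmx'⟩ := Finset.mem_filter.1 hm'
      have hv := c.view_union hJ hmm (hmx.trans hmx'.symm)
      exact messages_ext hK (c.eq_of_view_eq hm hm' (mem_msgNotLast_of_lt hK hj) hv)
        (c.eq_of_view_eq hm hm' (mem_msgNotPrev_of_lt hK hj) hv))
    -- The output of receiver `K - 1` determines both the shared view and its own message, so it
    -- bounds the number of such pairs; likewise for receiver `K` below.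
    (card_image_le_card_of_factor _ _ (c.view (containing (rxPrev hK) Finset.univ))
      fun m hm m' hm' hmm => Prod.ext (c.view_mono hWa hmm)
        (c.eq_of_view_eq hm hm' (rxPrev_mem_msgNotLast hK) hmm))
    (card_image_le_card_of_factor _ _ (c.view (containing (rxLast hK) Finset.univ))
      fun m hm m' hm' hmm => Prod.ext (c.view_mono hWb hmm)
        (c.eq_of_view_eq hm hm' (rxLast_mem_msgNotPrev hK) hmm))
  rw [card_block hC, card_block hC, card_block hC] at h2
  calc (size (msgNotLast hK) * size (msgNotPrev hK) : ℝ) ^ 2 ≤ (2 * c.goodSet.card) ^ 2 := by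
        gcongr
    _ = 4 * (c.goodSet.card : ℝ) ^ 2 := by ring
    _ ≤ _ := mul_le_mul_of_nonneg_left h2 (by norm_num)
    _ = _ := by
        rw [← Real.rpow_add (by norm_num), ← Real.rpow_add (by norm_num)]
        congr 2; ring

theorem rpow_le_messageSize (n : ℕ) (r : ℝ) : (2 : ℝ) ^ ((n : ℝ) * r) ≤ messageSize n r :=
  Nat.le_ceil _

theorem messageSize_pos (n : ℕ) (r : ℝ) : (0 : ℝ) < messageSize n r :=
  (Real.rpow_pos_of_pos (by norm_num) _).trans_le (rpow_le_messageSize n r)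

theorem rpow_mul_add_le (n : ℕ) (r s : ℝ) :
    (2 : ℝ) ^ ((n : ℝ) * (r + s)) ≤ messageSize n s * messageSize n r := by
  rw [mul_add, Real.rpow_add (by norm_num), mul_comm]
  exact mul_le_mul (rpow_le_messageSize n s) (rpow_le_messageSize n r) (by positivity)
    (messageSize_pos n s).le

theorem Achievable.bounds (hC : ∀ S, (Fintype.card (V S) : ℝ) = (2 : ℝ) ^ C S)
    {R : twoMsgs hK → ℝ} (hR : Achievable (network V) (twoMsgs hK) R) :
    0 ≤ R (msgNotPrev hK) ∧ 0 ≤ R (msgNotLast hK) ∧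
    R (msgNotPrev hK) ≤ capSum C (containing (rxLast hK) Finset.univ) ∧
    R (msgNotLast hK) ≤ capSum C (containing (rxPrev hK) Finset.univ) ∧
    (∀ j : Fin K, j.val < K - 2 →
      R (msgNotPrev hK) + R (msgNotLast hK) ≤ capSum C (containing j Finset.univ)) ∧
    R (msgNotPrev hK) + R (msgNotLast hK) ≤
      capSum C (downIn (containing (rxPrev hK) Finset.univ) {allBut hK (rxLast hK)}) +
        capSum C (containing (rxLast hK) Finset.univ) ∧
    (∀ j : Fin K, j.val < K - 2 →
      2 * R (msgNotPrev hK) + 2 * R (msgNotLast hK) ≤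
        capSum C (downIn (containing j Finset.univ)
          {allBut hK (rxPrev hK), allBut hK (rxLast hK)}) +
        capSum C (containing (rxLast hK) Finset.univ) +
        capSum C (containing (rxPrev hK) Finset.univ)) := by
  obtain ⟨h0, c, hc⟩ := hR
  have he : ∀ᶠ n in atTop, (c n).errorProb (network V) ≤ 1 / 2 :=
    hc.eventually_le_const (by norm_num)
  refine ⟨h0 _, h0 _, le_of_eventually_rpow_le (c := 2) ?_, le_of_eventually_rpow_le (c := 2) ?_,
    fun j hj => le_of_eventually_rpow_le (c := 2) ?_, le_of_eventually_rpow_le (c := 2) ?_,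
    fun j hj => le_of_eventually_rpow_le (c := 4) ?_⟩
  · filter_upwards [he] with n hn
    have h1 := mul_size_le_of_rxLast hK hC (c n) hn
    refine (rpow_le_messageSize n _).trans
      (le_of_mul_le_mul_right (a := (messageSize n (R (msgNotLast hK)) : ℝ)) ?_
        (messageSize_pos n _))
    linarith
  · filter_upwards [he] with n hn
    have h1 := mul_size_le_of_rxPrev hK hC (c n) hn
    refine (rpow_le_messageSize n _).trans
      (le_of_mul_le_mul_right (a := (messageSize n (R (msgNotPrev hK)) : ℝ)) ?_
        (messageSize_pos n _))
    linarith
  · filter_upwards [he] with n hn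
    exact (rpow_mul_add_le n _ _).trans (mul_size_le_of_view hK hC (c n) hn subset_rfl subset_rfl
      (mem_msgNotLast_of_lt hK hj) (mem_msgNotPrev_of_lt hK hj))
  · rw [capSum_downIn_add_capSum]
    filter_upwards [he] with n hn
    exact (rpow_mul_add_le n _ _).trans (mul_size_le_of_view hK hC (c n) hn
      (fun S hS => by simpa using Or.inl (mem_containing_univ.1 hS))
      (fun S hS => by simpa using Or.inr (mem_containing_univ.1 hS))
      (rxPrev_mem_msgNotLast hK) (rxLast_mem_msgNotPrev hK))
  · filter_upwards [he] with n hn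
    refine le_trans ?_ (mul_size_sq_le hK hC (c n) hn hj)
    have h1 := rpow_mul_add_le n (R (msgNotPrev hK)) (R (msgNotLast hK))
    have h2 := pow_le_pow_left₀ (by positivity) h1 2
    rw [← Real.rpow_mul_natCast (by norm_num)] at h2
    refine le_trans (le_of_eq ?_) h2
    congr 1; push_cast; ring

end Converse

end TwoMessages

/-! ### Random codebooks and the union bound -/

section RandomCoding

/-- A random function agrees at two distinct points with probability `1 / |B|`: overwriting the
value at `a'` of an agreeing function by an arbitrary `b` is a bijection onto all functions. -/
theorem card_agree_mul_card {A B : Type*} [Fintype A] [DecidableEq A] [Fintype B] {a a' : A}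
    [DecidablePred fun f : A → B => f a = f a'] (h : a ≠ a') :
    (Finset.univ.filter fun f : A → B => f a = f a').card * Fintype.card B =
      Fintype.card (A → B) := by
  rw [← Finset.card_univ (α := B), ← Finset.card_product, ← Finset.card_univ (α := A → B)]
  refine Finset.card_nbij' (fun p => Function.update p.1 a' p.2)
    (fun g => (Function.update g a' (g a), g a')) ?_ ?_ ?_ ?_
  · intro p _
    simp
  · intro g _
    simp [Function.update_of_ne h]
  · rintro ⟨f, b⟩ hf
    have hf' : f a = f a' := by simpa using hf
    simp [Function.update_of_ne h, hf']
  · intro g _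
    simp

theorem card_agree_le {A B : Type*} [Fintype A] [DecidableEq A] [Fintype B] [Nonempty B]
    {p : Prop} (hp : p) {a a' : A} [DecidablePred fun f : A → B => p → f a = f a'] (h : a ≠ a') :
    ((Finset.univ.filter fun f : A → B => p → f a = f a').card : ℝ) ≤
      Fintype.card (A → B) * (Fintype.card B : ℝ)⁻¹ := by
  classical
  rw [← card_agree_mul_card h]
  simp [hp]

variable {K : ℕ} {V : Idx K → Type*} {C : Idx K → ℝ} {ι : Type*} [Fintype ι]
  [DecidableEq ι] {N : ι → ℕ} {n : ℕ}

/-- Codebooks: the block sent on component `S` is a function of the coordinates in `T S` of the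
message tuple. -/
abbrev Codebook (V : Idx K → Type*) (T : Idx K → Finset ι) (N : ι → ℕ) (n : ℕ) : Type _ :=
  ∀ S : Idx K, (∀ i : T S, Fin (N i)) → (Fin n → V S)

/-- Receiver `k` sees the same output for the message tuples `m` and `m'`. -/
def Collides {T : Idx K → Finset ι} (F : Codebook V T N n) (k : Fin K)
    (m m' : ∀ i, Fin (N i)) : Prop :=
  ∀ S : Idx K, k ∈ S.1 → F S (Finset.restrict (T S) m) = F S (Finset.restrict (T S) m')

/-- The coordinates in which two tuples differ. -/
def diffSet (m m' : ∀ i, Fin (N i)) : Finset ι := Finset.univ.filter fun i => m i ≠ m' i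

/-- The components that receiver `k` sees and that depend on some coordinate in `D`. -/
def seeing (T : Idx K → Finset ι) (k : Fin K) (D : Finset ι) : Finset (Idx K) :=
  (containing k Finset.univ).filter fun S => ¬ Disjoint (T S) D

/-- Some receiver `k` cannot tell `m` from a tuple that differs from it only inside `U k`. -/
def Confusable {T : Idx K → Finset ι} (U : Fin K → Finset ι) (F : Codebook V T N n)
    (m : ∀ i, Fin (N i)) : Prop :=
  ∃ k, ∃ m' : ∀ i, Fin (N i), (diffSet m m' ⊆ U k ∧ (diffSet m m').Nonempty) ∧ Collides F k m m'

/-- A collision at a receiver that sees only coordinates in `U k` between tuples that differ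
inside `U k` makes the first tuple confusable. -/
theorem Confusable.of_collides {T : Idx K → Finset ι} {U : Fin K → Finset ι}
    (hU : ∀ S k, k ∈ S.1 → T S ⊆ U k) {F : Codebook V T N n} {k : Fin K}
    {m m' : ∀ i, Fin (N i)} (h : Collides F k m m') {i : ι} (hi : i ∈ U k) (hne : m i ≠ m' i) :
    Confusable U F m := by
  -- Resetting `m'` to `m` outside `U k` changes nothing that receiver `k` sees.
  refine ⟨k, fun i => if i ∈ U k then m' i else m i, ⟨?_, i, ?_⟩, ?_⟩
  · intro i' hi'
    by_contra hc
    simp [diffSet, hc] at hi'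
  · simpa [diffSet, hi] using hne
  · intro S hS
    rw [h S hS]
    congr 1
    funext i'
    simp [hU S k hS i'.2]

theorem restrict_eq_iff_disjoint_diffSet (s : Finset ι) (m m' : ∀ i, Fin (N i)) :
    s.restrict m = s.restrict m' ↔ Disjoint s (diffSet m m') := by
  rw [Finset.disjoint_left, funext_iff]
  simp [diffSet]

/-- The exact factor `N i - 1` matters: it vanishes for a part of rate zero, where no exponential
decay may be available. -/
theorem card_diffSet_eq (m : ∀ i, Fin (N i)) (D : Finset ι) :
    (Finset.univ.filter fun m' => diffSet m m' = D).card = ∏ i ∈ D, (N i - 1) := by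
  have h : (Finset.univ.filter fun m' => diffSet m m' = D) =
      Fintype.piFinset fun i => if i ∈ D then ({m i}ᶜ : Finset (Fin (N i))) else {m i} := by
    ext m'
    simp only [Finset.mem_filter, Finset.mem_univ, true_and, Fintype.mem_piFinset,
      Finset.ext_iff, diffSet]
    refine forall_congr' fun i => ?_
    split_ifs with hi <;> simp [hi, eq_comm]
  rw [h, Fintype.card_piFinset, ← Finset.prod_subset (Finset.subset_univ D)]
  · refine Finset.prod_congr rfl fun i hi => ?_
    rw [if_pos hi, Finset.card_compl, Finset.card_singleton, Fintype.card_fin]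
  · intro i _ hi
    rw [if_neg hi, Finset.card_singleton]

variable [∀ S, Fintype (V S)]

theorem nonempty_of_card_eq_rpow (hC : ∀ S, (Fintype.card (V S) : ℝ) = (2 : ℝ) ^ C S)
    (S : Idx K) : Nonempty (V S) := by
  rw [← Fintype.card_pos_iff]
  have : (0 : ℝ) < Fintype.card (V S) := by rw [hC]; positivity
  exact_mod_cast this

open Classical in
-- The components of the codebook are independent. One in `seeing` receives distinct arguments from
-- `m` and `m'` and agrees with probability `2 ^ (-n C_S)`; the others are bounded by 1.
theorem card_collides_le (hC : ∀ S, (Fintype.card (V S) : ℝ) = (2 : ℝ) ^ C S)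
    (T : Idx K → Finset ι) (k : Fin K) (m m' : ∀ i, Fin (N i)) :
    ((Finset.univ.filter fun F : Codebook V T N n => Collides F k m m').card : ℝ) ≤
      Fintype.card (Codebook V T N n) *
        (2 : ℝ) ^ (-((n : ℝ) * capSum C (seeing T k (diffSet m m')))) := by
  have h : (Finset.univ.filter fun F : Codebook V T N n => Collides F k m m') =
      Fintype.piFinset fun S => Finset.univ.filter fun f : (∀ i : T S, Fin (N i)) → (Fin n → V S) =>
        k ∈ S.1 → f (Finset.restrict (T S) m) = f (Finset.restrict (T S) m') := by
    ext F
    simp [Collides]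
  have hV := nonempty_of_card_eq_rpow hC
  have hexp : (2 : ℝ) ^ (-((n : ℝ) * capSum C (seeing T k (diffSet m m')))) =
      ∏ S : Idx K, if S ∈ seeing T k (diffSet m m') then (((2 : ℝ) ^ C S) ^ n)⁻¹ else 1 := by
    rw [Finset.prod_ite_mem, Finset.univ_inter, Finset.prod_inv_distrib, Finset.prod_pow,
      Real.rpow_neg (by norm_num), mul_comm, Real.rpow_mul (by norm_num), Real.rpow_natCast,
      capSum, Real.rpow_sum_of_pos (by norm_num)]
  rw [h, Fintype.card_piFinset, hexp, Fintype.card_pi, Nat.cast_prod, Nat.cast_prod,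
    ← Finset.prod_mul_distrib]
  refine Finset.prod_le_prod (fun _ _ => Nat.cast_nonneg _) fun S _ => ?_
  split_ifs with hS
  · simp only [seeing, Finset.mem_filter, mem_containing_univ,
      ← restrict_eq_iff_disjoint_diffSet] at hS
    have hB : (((2 : ℝ) ^ C S) ^ n) = (Fintype.card (Fin n → V S) : ℝ) := by
      rw [Fintype.card_fun, Fintype.card_fin, Nat.cast_pow, hC S]
    rw [hB]
    exact card_agree_le hS.1 hS.2
  · rw [mul_one]
    exact Nat.cast_le.2 (Finset.card_le_univ _)

/-- The union bound on the error probability of random codebooks. -/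
noncomputable def unionBound (C : Idx K → ℝ) (T : Idx K → Finset ι) (U : Fin K → Finset ι)
    (N : ι → ℕ) (n : ℕ) : ℝ :=
  ∑ k : Fin K, ∑ D ∈ (U k).powerset.filter (·.Nonempty),
    (∏ i ∈ D, ((N i - 1 : ℕ) : ℝ)) * (2 : ℝ) ^ (-((n : ℝ) * capSum C (seeing T k D)))

open Classical in
theorem card_confusable_le (hC : ∀ S, (Fintype.card (V S) : ℝ) = (2 : ℝ) ^ C S)
    (T : Idx K → Finset ι) (U : Fin K → Finset ι) (m : ∀ i, Fin (N i)) :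
    ((Finset.univ.filter fun F : Codebook V T N n => Confusable U F m).card : ℝ) ≤
      Fintype.card (Codebook V T N n) * unionBound C T U N n := by
  have hsub : (Finset.univ.filter fun F : Codebook V T N n => Confusable U F m) ⊆
      Finset.univ.biUnion fun k : Fin K =>
        ((U k).powerset.filter (·.Nonempty)).biUnion fun D =>
          (Finset.univ.filter fun m' => diffSet m m' = D).biUnion fun m' =>
            Finset.univ.filter fun F : Codebook V T N n => Collides F k m m' := by
    intro F hF
    obtain ⟨k, m', ⟨h1, h2⟩, h3⟩ := (Finset.mem_filter.1 hF).2
    simp only [Finset.mem_biUnion, Finset.mem_filter, Finset.mem_univ, true_and,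
      Finset.mem_powerset]
    exact ⟨k, diffSet m m', ⟨h1, h2⟩, m', rfl, h3⟩
  have h1 : (Finset.univ.filter fun F : Codebook V T N n => Confusable U F m).card ≤
      ∑ k : Fin K, ∑ D ∈ (U k).powerset.filter (·.Nonempty),
        ∑ m' ∈ Finset.univ.filter (fun m' => diffSet m m' = D),
          (Finset.univ.filter fun F : Codebook V T N n => Collides F k m m').card :=
    (Finset.card_le_card hsub).trans <| Finset.card_biUnion_le.trans <|
      Finset.sum_le_sum fun k _ => Finset.card_biUnion_le.trans <|
        Finset.sum_le_sum fun D _ => Finset.card_biUnion_le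
  refine (Nat.cast_le.2 h1).trans ?_
  rw [unionBound, Finset.mul_sum]
  push_cast
  refine Finset.sum_le_sum fun k _ => ?_
  rw [Finset.mul_sum]
  refine Finset.sum_le_sum fun D _ => ?_
  calc _ ≤ ∑ m' ∈ Finset.univ.filter (fun m' => diffSet m m' = D),
        (Fintype.card (Codebook V T N n) *
          (2 : ℝ) ^ (-((n : ℝ) * capSum C (seeing T k D)))) := by
        refine Finset.sum_le_sum fun m' hm' => ?_
        rw [← (Finset.mem_filter.1 hm').2]
        exact card_collides_le hC T k m m'
    _ = _ := by
        rw [Finset.sum_const, card_diffSet_eq, nsmul_eq_mul]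
        push_cast
        ring

open Classical in
-- Some codebook is no worse than the average. Only the messages in `M` are averaged, since they
-- need not fill the product of the part sets.
theorem exists_codebook (hC : ∀ S, (Fintype.card (V S) : ℝ) = (2 : ℝ) ^ C S)
    (T : Idx K → Finset ι) (U : Fin K → Finset ι) {M : Type*} [Fintype M]
    (e : M → ∀ i, Fin (N i)) :
    ∃ F : Codebook V T N n,
      ((Finset.univ.filter fun m => Confusable U F (e m)).card : ℝ) ≤
        Fintype.card M * unionBound C T U N n := by
  have hV := nonempty_of_card_eq_rpow hC
  have hne : (Finset.univ : Finset (Codebook V T N n)).Nonempty := Finset.univ_nonempty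
  obtain ⟨F, -, hF⟩ := Finset.exists_le_of_sum_le hne
    (f := fun F => ((Finset.univ.filter fun m => Confusable U F (e m)).card : ℝ))
    (g := fun _ => Fintype.card M * unionBound C T U N n) (by
      calc _ = ∑ m : M, ((Finset.univ.filter fun F : Codebook V T N n =>
            Confusable U F (e m)).card : ℝ) := by
            simp only [← Finset.sum_boole]
            rw [Finset.sum_comm]
        _ ≤ ∑ m : M, Fintype.card (Codebook V T N n) * unionBound C T U N n :=
            Finset.sum_le_sum fun m _ => card_confusable_le hC T U (e m)
        _ = _ := by
            simp only [Finset.sum_const, Finset.card_univ, nsmul_eq_mul]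
            ring)
  exact ⟨F, hF⟩

theorem exists_code (hC : ∀ S, (Fintype.card (V S) : ℝ) = (2 : ℝ) ^ C S)
    {E : Finset (Idx K)} {size : E → ℕ} (hpos : ∀ S, 0 < size S) {N : E × Bool → ℕ}
    (hN : ∀ S, size S ≤ N (S, true) * N (S, false))
    (T : Idx K → Finset (E × Bool)) (U : Fin K → Finset (E × Bool))
    (hU : ∀ S k, k ∈ S.1 → T S ⊆ U k) (hE : ∀ (S : E) k t, k ∈ S.1.1 → (S, t) ∈ U k) :
    ∃ c : Code (Input V) (Output V) E size n,
      c.errorProb (network V) ≤ unionBound C T U N n := by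
  classical
  have hinj : ∀ S : E, Nonempty (Fin (size S) ↪ ∀ t : Bool, Fin (N (S, t))) := fun S => by
    refine Function.Embedding.nonempty_of_card_le ?_
    simpa using hN S
  let e₀ : ∀ S : E, Fin (size S) ↪ ∀ t : Bool, Fin (N (S, t)) := fun S => (hinj S).some
  have : ∀ S, NeZero (size S) := fun S => ⟨(hpos S).ne'⟩
  let e : (∀ S : E, Fin (size S)) → ∀ i : E × Bool, Fin (N i) := fun m i => e₀ i.1 (m i.1) i.2
  obtain ⟨F, hF⟩ := exists_codebook (n := n) hC T U e
  let send : (∀ i, Fin (N i)) → Fin n → Input V :=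
    fun m t S => F S (Finset.restrict (T S) m) t
  -- Decode by any tuple of parts consistent with the output, even one encoding no message. The
  -- default 0 is never used on outputs of actual codewords.
  let guess : ∀ k : Fin K, (Fin n → Output V k) → ∀ S : E, Fin (size S) := fun k y S =>
    if h : ∃ m, (fun t => received (send m t) k) = y then
      Function.invFun (e₀ S) (fun t => h.choose (S, t))
    else 0
  refine ⟨⟨fun m => send (e m), fun k y S _ => guess k y S⟩, ?_⟩
  set c : Code (Input V) (Output V) E size n :=
    ⟨fun m => send (e m), fun k y S _ => guess k y S⟩ with hc
  have hbad : ∀ m, ¬ Confusable U F (e m) → m ∈ c.goodSet := by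
    intro m hm
    simp only [Code.goodSet, Code.Errs, Finset.mem_filter, Finset.mem_univ, true_and, not_exists,
      not_not]
    intro k S hk
    have hex : ∃ m', (fun t => received (send m' t) k) =
        fun t => received (c.enc m t) k := ⟨e m, rfl⟩
    have hcol : Collides F k (e m) hex.choose := by
      intro S' hS'
      funext t
      exact (congrFun (congrFun hex.choose_spec t) ⟨S', mem_containing_univ.2 hS'⟩).symm
    have heq : (fun t => hex.choose (S, t)) = e₀ S (m S) := by
      funext t
      by_contra hne
      exact hm (Confusable.of_collides hU hcol (hE S k t hk) (Ne.symm hne))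
    change guess k (fun t => received (c.enc m t) k) S = m S
    simp only [guess]
    rw [dif_pos hex, heq]
    exact Function.leftInverse_invFun (e₀ S).injective _
  have hle : c.goodSetᶜ.card ≤ (Finset.univ.filter fun m => Confusable U F (e m)).card := by
    refine Finset.card_le_card fun m hm => ?_
    rw [Finset.mem_compl] at hm
    simpa using fun h => hm (hbad m h)
  rw [c.errorProb_network, div_le_iff₀ (by exact_mod_cast Fintype.card_pos), mul_comm]
  exact (Nat.cast_le.2 hle).trans hF

end RandomCoding

/-! ### From rate conditions to the capacity region -/

section Rates

variable {K : ℕ} {V : Idx K → Type*} [∀ S, Fintype (V S)] {C : Idx K → ℝ}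

theorem messageSize_sub_one_le (n : ℕ) (r : ℝ) :
    ((messageSize n r - 1 : ℕ) : ℝ) ≤ (2 : ℝ) ^ ((n : ℝ) * r) := by
  have h0 : 1 ≤ messageSize n r := Nat.one_le_iff_ne_zero.2 fun h => by
    simpa [h] using messageSize_pos n r
  rw [Nat.cast_sub h0, Nat.cast_one, sub_le_iff_le_add]
  exact (Nat.ceil_lt_add_one (by positivity)).le

theorem tendsto_unionBound {ι : Type*} [Fintype ι] [DecidableEq ι]
    (T : Idx K → Finset ι) (U : Fin K → Finset ι)
    {r : ι → ℝ} (hr : ∀ i, 0 ≤ r i)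
    (hcond : ∀ k, ∀ D ⊆ U k, D.Nonempty → ∑ i ∈ D, r i ≤ capSum C (seeing T k D))
    {θ : ℝ} (hθ : θ < 1) :
    Tendsto (fun n => unionBound C T U (fun i => messageSize n (θ * r i)) n) atTop (𝓝 0) := by
  unfold unionBound
  have hz : (0 : ℝ) = ∑ k : Fin K, ∑ D ∈ (U k).powerset.filter (·.Nonempty), 0 := by simp
  rw [hz]
  refine tendsto_finsetSum _ fun k _ => tendsto_finsetSum _ fun D hD => ?_
  simp only [Finset.mem_filter, Finset.mem_powerset] at hD
  -- A part of rate zero has one value, so the term is 0. Otherwise the total rate is positive and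
  -- scaling by `θ < 1` gives a strictly negative exponent.
  by_cases h0 : ∃ i ∈ D, r i = 0
  · obtain ⟨i, hi, hri⟩ := h0
    refine tendsto_const_nhds.congr fun n => ?_
    rw [Finset.prod_eq_zero hi, zero_mul]
    simp [hri, messageSize]
  · push Not at h0
    have hpos : 0 < ∑ i ∈ D, r i :=
      Finset.sum_pos (fun i hi => (hr i).lt_of_ne' (h0 i hi)) hD.2
    have hlt : θ * ∑ i ∈ D, r i - capSum C (seeing T k D) < 0 := by
      have := hcond k D hD.1 hD.2
      nlinarith
    refine squeeze_zero (g := fun n : ℕ =>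
      ((2 : ℝ) ^ (θ * ∑ i ∈ D, r i - capSum C (seeing T k D))) ^ n)
      (fun n => by positivity) (fun n => ?_)
      (tendsto_pow_atTop_nhds_zero_of_lt_one (by positivity)
        (Real.rpow_lt_one_of_one_lt_of_neg (by norm_num) hlt))
    calc _ ≤ (∏ i ∈ D, (2 : ℝ) ^ ((n : ℝ) * (θ * r i))) *
          (2 : ℝ) ^ (-((n : ℝ) * capSum C (seeing T k D))) := by
          gcongr with i hi
          exact messageSize_sub_one_le n _
      _ = _ := by
          rw [← Real.rpow_sum_of_pos (by norm_num), ← Real.rpow_add (by norm_num),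
            ← Real.rpow_natCast, ← Real.rpow_mul (by norm_num), ← Finset.mul_sum,
            ← Finset.mul_sum]
          congr 1; ring

/-- The rates scaled by `θ < 1` are achievable; as the region is a closure, letting `θ → 1` reaches
the non-strict conditions. -/
theorem mem_capacityRegion_of_split (hC : ∀ S, (Fintype.card (V S) : ℝ) = (2 : ℝ) ^ C S)
    {E : Finset (Idx K)} (T : Idx K → Finset (E × Bool)) (U : Fin K → Finset (E × Bool))
    (hU : ∀ S k, k ∈ S.1 → T S ⊆ U k) (hE : ∀ (S : E) k t, k ∈ S.1.1 → (S, t) ∈ U k)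
    {r : E × Bool → ℝ} (hr : ∀ i, 0 ≤ r i)
    (hcond : ∀ k, ∀ D ⊆ U k, D.Nonempty → ∑ i ∈ D, r i ≤ capSum C (seeing T k D)) :
    (fun S => r (S, true) + r (S, false)) ∈ capacityRegion (network V) E := by
  have hach : ∀ θ : ℝ, 0 < θ → θ < 1 →
      Achievable (network V) E (θ • fun S => r (S, true) + r (S, false)) := by
    intro θ h0 h1
    refine ⟨fun S => mul_nonneg h0.le (add_nonneg (hr _) (hr _)), ?_⟩
    have hex : ∀ n : ℕ, ∃ c : Code (Input V) (Output V) E (fun S => messageSize n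
        ((θ • fun S => r (S, true) + r (S, false)) S)) n, c.errorProb (network V) ≤
          unionBound C T U (fun i => messageSize n (θ * r i)) n := fun n =>
      exists_code hC (fun S => by exact_mod_cast messageSize_pos n _) (fun S => by
        refine Nat.ceil_le.2 ?_
        push_cast
        rw [Pi.smul_apply, smul_eq_mul, mul_add, add_comm]
        exact rpow_mul_add_le n _ _) T U hU hE
    choose c hc using hex
    refine ⟨c, squeeze_zero (fun n => ?_) hc (tendsto_unionBound T U hr hcond h1)⟩
    rw [Code.errorProb_network]
    positivity
  have hlim : Tendsto (fun θ : ℝ => θ • fun S : E => r (S, true) + r (S, false)) (𝓝[<] 1)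
      (𝓝 fun S => r (S, true) + r (S, false)) := by
    have h : Continuous fun θ : ℝ => θ • fun S : E => r (S, true) + r (S, false) := by fun_prop
    simpa using (h.tendsto 1).mono_left nhdsWithin_le_nhds
  refine mem_closure_of_tendsto hlim ?_
  filter_upwards [Ioo_mem_nhdsLT (zero_lt_one (α := ℝ))] with θ hθ
  exact hach θ hθ.1 hθ.2

end Rates

/-! ### Achievability: rate splitting for the two messages -/

section TwoMessages

variable {K : ℕ} (hK : 2 ≤ K)

theorem capSum_mono {C : Idx K → ℝ} (h : ∀ S, 0 ≤ C S) {W W' : Finset (Idx K)} (hW : W ⊆ W') :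
    capSum C W ≤ capSum C W' :=
  Finset.sum_le_sum_of_subset_of_nonneg hW fun S _ _ => h S

theorem capSum_nonneg {C : Idx K → ℝ} (h : ∀ S, 0 ≤ C S) (W : Finset (Idx K)) :
    0 ≤ capSum C W :=
  Finset.sum_nonneg fun S _ => h S

theorem nonneg_of_card_eq_rpow {V : Idx K → Type*} [∀ S, Fintype (V S)] {C : Idx K → ℝ}
    (hC : ∀ S, (Fintype.card (V S) : ℝ) = (2 : ℝ) ^ C S) (S : Idx K) : 0 ≤ C S := by
  have := nonempty_of_card_eq_rpow hC S
  have h : (1 : ℝ) ≤ Fintype.card (V S) := by exact_mod_cast Fintype.card_pos (α := V S)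
  rw [hC] at h
  by_contra! hneg
  exact absurd h (not_le.2 (Real.rpow_lt_one_of_one_lt_of_neg (by norm_num) hneg))

theorem capSum_containing_le (C : Idx K → ℝ) (h : ∀ S, 0 ≤ C S) (i k : Fin K) :
    capSum C (containing i Finset.univ) ≤
      capSum C (downIn (containing i Finset.univ) {allBut hK k}) +
        capSum C (containing k Finset.univ) := by
  rw [capSum_downIn_add_capSum]
  exact capSum_mono h fun S hS => by simpa using Or.inl (mem_containing_univ.1 hS)

theorem capSum_downIn_add_capSum_comm (C : Idx K → ℝ) (i k : Fin K) :
    capSum C (downIn (containing i Finset.univ) {allBut hK k}) +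
        capSum C (containing k Finset.univ) =
      capSum C (downIn (containing k Finset.univ) {allBut hK i}) +
        capSum C (containing i Finset.univ) := by
  rw [capSum_downIn_add_capSum, capSum_downIn_add_capSum]
  congr 1
  ext S
  simp [or_comm]

theorem lt_or_eq_rxPrev_or_eq_rxLast (k : Fin K) :
    k.val < K - 2 ∨ k = rxPrev hK ∨ k = rxLast hK := by
  simp only [rxPrev, rxLast, Fin.ext_iff]
  omega

/-- The message coordinates on which the component `V_S` depends: the common parts, and the
private parts of the messages intended for all receivers in `S`. -/
def usedParts (S : Idx K) : Finset (twoMsgs hK × Bool) :=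
  Finset.univ.filter fun i => i.2 = true ∨ S.1 ⊆ i.1.1.1

/-- The message coordinates that receiver `k` decodes. -/
def decodedParts (k : Fin K) : Finset (twoMsgs hK × Bool) :=
  Finset.univ.filter fun i => i.2 = true ∨ k ∈ i.1.1.1

/-- The rates of the message coordinates: `q` and `p` are the rates of the common parts. -/
noncomputable def partRate (R : twoMsgs hK → ℝ) (q p : ℝ) (i : twoMsgs hK × Bool) : ℝ :=
  if i.1 = msgNotLast hK then (if i.2 then q else R (msgNotLast hK) - q)
  else (if i.2 then p else R (msgNotPrev hK) - p)

theorem sum_partRate (R : twoMsgs hK → ℝ) (q p : ℝ) (D : Finset (twoMsgs hK × Bool)) :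
    ∑ i ∈ D, partRate hK R q p i =
      (if (msgNotLast hK, true) ∈ D then q else 0) +
      (if (msgNotLast hK, false) ∈ D then R (msgNotLast hK) - q else 0) +
      ((if (msgNotPrev hK, true) ∈ D then p else 0) +
      (if (msgNotPrev hK, false) ∈ D then R (msgNotPrev hK) - p else 0)) := by
  rw [← Finset.univ_inter D, ← Finset.sum_ite_mem, Fintype.sum_prod_type, univ_twoMsgs,
    Finset.sum_pair (msgNotLast_ne_msgNotPrev hK)]
  simp [partRate, (msgNotLast_ne_msgNotPrev hK).symm]

/-- Every component carries every common part, so among sets containing one, the full set decoded by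
`k` gives the strongest condition. -/
theorem seeing_of_common {k : Fin K} {D : Finset (twoMsgs hK × Bool)}
    (hD : ∃ i ∈ D, i.2 = true) : seeing (usedParts hK) k D = containing k Finset.univ := by
  obtain ⟨i, hi, hi'⟩ := hD
  refine Finset.filter_true_of_mem fun S _ => Finset.not_disjoint_iff.2 ⟨i, ?_, hi⟩
  simp [usedParts, hi']

theorem downIn_subset_seeing {k : Fin K} {D : Finset (twoMsgs hK × Bool)}
    {Q : Finset (Idx K)} (hQ : ∀ T ∈ Q, ∃ i ∈ D, i.1.1 = T) :
    downIn (containing k Finset.univ) Q ⊆ seeing (usedParts hK) k D := by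
  intro S hS
  obtain ⟨hS, T, hT, hST⟩ := Finset.mem_filter.1 hS
  obtain ⟨i, hi, rfl⟩ := hQ T hT
  refine Finset.mem_filter.2 ⟨hS, Finset.not_disjoint_iff.2 ⟨i, ?_, hi⟩⟩
  exact Finset.mem_filter.2 ⟨Finset.mem_univ _, Or.inr hST⟩

theorem sum_partRate_le_of_private {C : Idx K → ℝ} (hC0 : ∀ S, 0 ≤ C S) {R : twoMsgs hK → ℝ}
    {q p : ℝ} {k : Fin K} {D : Finset (twoMsgs hK × Bool)} (hD : ∀ i ∈ D, i.2 = false)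
    (hl : (msgNotLast hK, false) ∈ D → R (msgNotLast hK) - q ≤
      capSum C (downIn (containing k Finset.univ) {allBut hK (rxLast hK)}))
    (hp : (msgNotPrev hK, false) ∈ D → R (msgNotPrev hK) - p ≤
      capSum C (downIn (containing k Finset.univ) {allBut hK (rxPrev hK)}))
    (hlp : (msgNotLast hK, false) ∈ D → (msgNotPrev hK, false) ∈ D →
      R (msgNotLast hK) - q + (R (msgNotPrev hK) - p) ≤
        capSum C (downIn (containing k Finset.univ)
          {allBut hK (rxPrev hK), allBut hK (rxLast hK)})) :
    ∑ i ∈ D, partRate hK R q p i ≤ capSum C (seeing (usedParts hK) k D) := by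
  have hcom : ∀ S, (S, true) ∉ D := fun S h => Bool.noConfusion (hD _ h)
  rw [sum_partRate, if_neg (hcom _), if_neg (hcom _), zero_add, zero_add]
  by_cases h1 : (msgNotLast hK, false) ∈ D <;> by_cases h2 : (msgNotPrev hK, false) ∈ D
  · rw [if_pos h1, if_pos h2]
    refine (hlp h1 h2).trans (capSum_mono hC0 (downIn_subset_seeing hK fun T hT => ?_))
    rcases Finset.mem_insert.1 hT with rfl | hT
    · exact ⟨_, h2, rfl⟩
    · exact ⟨_, h1, (Finset.mem_singleton.1 hT).symm⟩
  · rw [if_pos h1, if_neg h2, add_zero]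
    exact (hl h1).trans (capSum_mono hC0 (downIn_subset_seeing hK fun T hT =>
      ⟨_, h1, (Finset.mem_singleton.1 hT).symm⟩))
  · rw [if_neg h1, if_pos h2, zero_add]
    exact (hp h2).trans (capSum_mono hC0 (downIn_subset_seeing hK fun T hT =>
      ⟨_, h2, (Finset.mem_singleton.1 hT).symm⟩))
  · rw [if_neg h1, if_neg h2, add_zero]
    exact capSum_nonneg hC0 _

theorem mem_capacityRegion_of_bounds {V : Idx K → Type*} [∀ S, Fintype (V S)] {C : Idx K → ℝ}
    (hC : ∀ S, (Fintype.card (V S) : ℝ) = (2 : ℝ) ^ C S) {R : twoMsgs hK → ℝ}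
    (hp0 : 0 ≤ R (msgNotPrev hK)) (hl0 : 0 ≤ R (msgNotLast hK))
    (hp : R (msgNotPrev hK) ≤ capSum C (containing (rxLast hK) Finset.univ))
    (hl : R (msgNotLast hK) ≤ capSum C (containing (rxPrev hK) Finset.univ))
    (hj : ∀ j : Fin K, j.val < K - 2 →
      R (msgNotPrev hK) + R (msgNotLast hK) ≤ capSum C (containing j Finset.univ))
    (hlp : R (msgNotPrev hK) + R (msgNotLast hK) ≤
      capSum C (downIn (containing (rxPrev hK) Finset.univ) {allBut hK (rxLast hK)}) +
        capSum C (containing (rxLast hK) Finset.univ))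
    (hj2 : ∀ j : Fin K, j.val < K - 2 →
      2 * R (msgNotPrev hK) + 2 * R (msgNotLast hK) ≤
        capSum C (downIn (containing j Finset.univ)
          {allBut hK (rxPrev hK), allBut hK (rxLast hK)}) +
        capSum C (containing (rxLast hK) Finset.univ) +
        capSum C (containing (rxPrev hK) Finset.univ)) :
    R ∈ capacityRegion (network V) (twoMsgs hK) := by
  have hC0 := nonneg_of_card_eq_rpow hC
  -- Receiver `K` decodes its own message and the common part of the other, so `q` is the largest
  -- rate with `R (msgNotPrev hK) + q ≤ C_{W_K}`; `p` is chosen likewise for receiver `K - 1`.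
  obtain ⟨q, hq⟩ : ∃ q, q = min (R (msgNotLast hK))
    (capSum C (containing (rxLast hK) Finset.univ) - R (msgNotPrev hK)) := ⟨_, rfl⟩
  obtain ⟨p, hpp⟩ : ∃ p, p = min (R (msgNotPrev hK))
    (capSum C (containing (rxPrev hK) Finset.univ) - R (msgNotLast hK)) := ⟨_, rfl⟩
  have hq0 : 0 ≤ q := hq ▸ le_min hl0 (by linarith)
  have hp'0 : 0 ≤ p := hpp ▸ le_min hp0 (by linarith)
  have hq1 : q ≤ R (msgNotLast hK) := hq ▸ min_le_left _ _
  have hp1 : p ≤ R (msgNotPrev hK) := hpp ▸ min_le_left _ _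
  have hq2 : q ≤ capSum C (containing (rxLast hK) Finset.univ) - R (msgNotPrev hK) :=
    hq ▸ min_le_right _ _
  have hp2 : p ≤ capSum C (containing (rxPrev hK) Finset.univ) - R (msgNotLast hK) :=
    hpp ▸ min_le_right _ _
  -- the private parts fit into the components that only their receivers see
  have hprivL : ∀ k, R (msgNotPrev hK) + R (msgNotLast hK) ≤
      capSum C (downIn (containing k Finset.univ) {allBut hK (rxLast hK)}) +
        capSum C (containing (rxLast hK) Finset.univ) →
      R (msgNotLast hK) - q ≤
        capSum C (downIn (containing k Finset.univ) {allBut hK (rxLast hK)}) := by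
    intro k hk
    rcases min_choice (R (msgNotLast hK))
      (capSum C (containing (rxLast hK) Finset.univ) - R (msgNotPrev hK)) with h | h
    · have := capSum_nonneg hC0 (downIn (containing k Finset.univ) {allBut hK (rxLast hK)})
      linarith
    · linarith
  have hprivP : ∀ k, R (msgNotPrev hK) + R (msgNotLast hK) ≤
      capSum C (downIn (containing k Finset.univ) {allBut hK (rxPrev hK)}) +
        capSum C (containing (rxPrev hK) Finset.univ) →
      R (msgNotPrev hK) - p ≤
        capSum C (downIn (containing k Finset.univ) {allBut hK (rxPrev hK)}) := by
    intro k hk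
    rcases min_choice (R (msgNotPrev hK))
      (capSum C (containing (rxPrev hK) Finset.univ) - R (msgNotLast hK)) with h | h
    · have := capSum_nonneg hC0 (downIn (containing k Finset.univ) {allBut hK (rxPrev hK)})
      linarith
    · linarith
  have hr0 : ∀ i, 0 ≤ partRate hK R q p i := by
    intro i
    unfold partRate
    split_ifs <;> linarith
  have hR : (fun S => partRate hK R q p (S, true) + partRate hK R q p (S, false)) = R := by
    funext S
    rcases eq_msgNotLast_or_eq_msgNotPrev hK S with rfl | rfl
    · simp [partRate]
    · simp [partRate, (msgNotLast_ne_msgNotPrev hK).symm]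
  rw [← hR]
  refine mem_capacityRegion_of_split hC (usedParts hK) (decodedParts hK) ?_ ?_ hr0 ?_
  · intro S k hk i hi
    simp only [usedParts, decodedParts, Finset.mem_filter, Finset.mem_univ, true_and] at hi ⊢
    exact hi.imp_right fun h => h hk
  · intro S k t hk
    simp [decodedParts, hk]
  · intro k D hDU _
    by_cases hcom : ∃ i ∈ D, i.2 = true
    · rw [seeing_of_common hK hcom]
      refine (Finset.sum_le_sum_of_subset_of_nonneg hDU fun i _ _ => hr0 i).trans ?_
      rw [sum_partRate]
      simp only [decodedParts, Finset.mem_filter, Finset.mem_univ, true_and, true_or, if_true,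
        Bool.false_eq_true, false_or]
      rcases lt_or_eq_rxPrev_or_eq_rxLast hK k with hk | rfl | rfl
      · rw [if_pos (mem_msgNotLast_of_lt hK hk), if_pos (mem_msgNotPrev_of_lt hK hk)]
        linarith [hj k hk]
      · rw [if_pos (rxPrev_mem_msgNotLast hK), if_neg (rxPrev_notMem_msgNotPrev hK)]
        linarith
      · rw [if_neg (rxLast_notMem_msgNotLast hK), if_pos (rxLast_mem_msgNotPrev hK)]
        linarith
    · push Not at hcom
      have hcom' : ∀ i ∈ D, i.2 = false := fun i hi => by simpa using hcom i hi
      have hmem : ∀ S : twoMsgs hK, (S, false) ∈ D → k ∈ S.1.1 := fun S h => by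
        simpa [decodedParts] using hDU h
      rcases lt_or_eq_rxPrev_or_eq_rxLast hK k with hk | rfl | rfl
      · have hL := hprivL k ((hj k hk).trans (capSum_containing_le hK C hC0 k (rxLast hK)))
        have hP := hprivP k ((hj k hk).trans (capSum_containing_le hK C hC0 k (rxPrev hK)))
        refine sum_partRate_le_of_private hK hC0 hcom' (fun _ => hL) (fun _ => hP) fun _ _ => ?_
        have hL' : capSum C (downIn (containing k Finset.univ) {allBut hK (rxLast hK)}) ≤
            capSum C (downIn (containing k Finset.univ)
              {allBut hK (rxPrev hK), allBut hK (rxLast hK)}) :=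
          capSum_mono hC0 (Finset.monotone_filter_right _ fun S _ => by simp +contextual)
        have hP' : capSum C (downIn (containing k Finset.univ) {allBut hK (rxPrev hK)}) ≤
            capSum C (downIn (containing k Finset.univ)
              {allBut hK (rxPrev hK), allBut hK (rxLast hK)}) :=
          capSum_mono hC0 (Finset.monotone_filter_right _ fun S _ => by simp +contextual)
        -- If either private rate is zero, the bound on the other suffices. Otherwise both minima
        -- are the capacity terms, and the claim is exactly the last inequality.
        rcases min_choice (R (msgNotLast hK))
          (capSum C (containing (rxLast hK) Finset.univ) - R (msgNotPrev hK)) with h | h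
        · linarith
        · rcases min_choice (R (msgNotPrev hK))
            (capSum C (containing (rxPrev hK) Finset.univ) - R (msgNotLast hK)) with h' | h'
          · linarith
          · linarith [hj2 k hk]
      · have hno : (msgNotPrev hK, false) ∉ D := fun h => rxPrev_notMem_msgNotPrev hK (hmem _ h)
        exact sum_partRate_le_of_private hK hC0 hcom' (fun _ => hprivL _ hlp)
          (fun h => absurd h hno) fun _ h => absurd h hno
      · have hno : (msgNotLast hK, false) ∉ D := fun h => rxLast_notMem_msgNotLast hK (hmem _ h)
        rw [capSum_downIn_add_capSum_comm] at hlp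
        exact sum_partRate_le_of_private hK hC0 hcom' (fun h => absurd h hno)
          (fun _ => hprivP _ hlp) fun h => absurd h hno

end TwoMessages

end CombinationNetwork

theorem mainTheorem3 {K : ℕ} (hK : 2 ≤ K) (V : Idx K → Type*) [∀ S, Fintype (V S)]
    (C : Idx K → ℝ) (hC : ∀ S, (Fintype.card (V S) : ℝ) = (2 : ℝ) ^ C S) :
    capacityRegion (network V) (twoMsgs hK) =
      {R : twoMsgs hK → ℝ |
        0 ≤ R (msgNotPrev hK) ∧ 0 ≤ R (msgNotLast hK) ∧
        R (msgNotPrev hK) ≤ capSum C (containing (rxLast hK) Finset.univ) ∧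
        R (msgNotLast hK) ≤ capSum C (containing (rxPrev hK) Finset.univ) ∧
        (∀ j : Fin K, j.val < K - 2 →
          R (msgNotPrev hK) + R (msgNotLast hK) ≤ capSum C (containing j Finset.univ)) ∧
        R (msgNotPrev hK) + R (msgNotLast hK) ≤
          capSum C (downIn (containing (rxPrev hK) Finset.univ) {allBut hK (rxLast hK)}) +
            capSum C (containing (rxLast hK) Finset.univ) ∧
        (∀ j : Fin K, j.val < K - 2 →
          2 * R (msgNotPrev hK) + 2 * R (msgNotLast hK) ≤
            capSum C (downIn (containing j Finset.univ)
              {allBut hK (rxPrev hK), allBut hK (rxLast hK)}) +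
            capSum C (containing (rxLast hK) Finset.univ) +
            capSum C (containing (rxPrev hK) Finset.univ))} ∧
    (∀ R : twoMsgs hK → ℝ,
      R (msgNotPrev hK) + R (msgNotLast hK) ≤
          capSum C (downIn (containing (rxPrev hK) Finset.univ) {allBut hK (rxLast hK)}) +
            capSum C (containing (rxLast hK) Finset.univ) ↔
      R (msgNotPrev hK) + R (msgNotLast hK) ≤
          capSum C (downIn (containing (rxLast hK) Finset.univ) {allBut hK (rxPrev hK)}) +
            capSum C (containing (rxPrev hK) Finset.univ)) := by
  refine ⟨Set.Subset.antisymm ?_ ?_, fun R => by rw [capSum_downIn_add_capSum_comm]⟩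
  -- The bounds pass to the closure because they are non-strict and continuous in the rates.
  · refine closure_minimal (fun R hR => Achievable.bounds hK hC hR) ?_
    simp only [Set.ofPred_and, Set.ofPred_forall]
    refine IsClosed.inter ?_ <| IsClosed.inter ?_ <| IsClosed.inter ?_ <| IsClosed.inter ?_ <|
      IsClosed.inter ?_ <| IsClosed.inter ?_ ?_
    any_goals refine isClosed_iInter fun j => isClosed_iInter fun _ => ?_
    all_goals exact isClosed_le (by fun_prop) (by fun_prop)
  · rintro R ⟨h1, h2, h3, h4, h5, h6, h7⟩
    exact mem_capacityRegion_of_bounds hK hC h1 h2 h3 h4 h5 h6 h7
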